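/- Let $n\ge 1$, and let $\mathcal K_o^n$ be the set of compact convex sets $K\subset\mathbb R^n$ with the origin $o$ in their interiors. For $K\in\mathcal K_o^n$ and $u\in S^{n-1}$ let $\rho_K(u)=\sup\{\lambda>0:\lambda u\in K\}$, $h_K(u)=\sup_{x\in K}\langle x,u\rangle$, $H(K,u)=\{x\in\mathbb R^n:\langle x,u\rangle=h_K(u)\}$, and for $\eta\subseteq S^{n-1}$ let $$\alpha^*_K(\eta)=\Big\{\frac{x}{|x|}: x\in\partial K\cap H(K,u)\text{ for some }u\in\eta\Big\}.$$ Let $\phi:\mathbb R^n\setminus\{o\}\to(0,\infty)$ be a continuous function satisfying condition C1): for each fixed $t>0$ the function $u\mapsto\Phi(t,u)=\int_t^\infty\phi(ru)r^{n-1}\,dr$ is finite, positive and continuous on $S^{n-1}$. For $K\in\mathcal K_o^n$ and Borel sets $\eta\subseteq S^{n-1}$ put $$\widetilde C_{\phi,\mathcal V}(K,\eta)=\int_{\alpha^*_K(\eta)}\phi(\rho_K(u)u)\,\rho_K(u)^n\,du,$$ where $du$ is the spherical measure on $S^{n-1}$. Then $\widetilde C_{\phi,\mathcal V}(K,\cdot)$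 is a finite Borel measure on $S^{n-1}$ for each $K\in\mathcal K_o^n$; and if $K_1,K_2,\ldots\in\mathcal K_o^n$ converge to $K\in\mathcal K_o^n$ in the Hausdorff metric, then $\widetilde C_{\phi,\mathcal V}(K_i,\cdot)$ converges weakly to $\widetilde C_{\phi,\mathcal V}(K,\cdot)$ as $i\to\infty$; that is, $\int g\,d\widetilde C_{\phi,\mathcal V}(K_i,\cdot)\to\int g\,d\widetilde C_{\phi,\mathcal V}(K,\cdot)$ for every continuous $g:S^{n-1}\to\mathbb R$. -/

import Mathlib

open MeasureTheory Filter Topology Set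
open scoped RealInnerProductSpace

namespace DualOrlicz

/-- The unit sphere of `ℝⁿ`. -/
abbrev Sph (n : ℕ) : Type := Metric.sphere (0 : EuclideanSpace ℝ (Fin n)) 1

/-- The spherical (surface) measure on the unit sphere. -/
noncomputable abbrev sphMeasure (n : ℕ) : Measure (Sph n) :=
  (volume : Measure (EuclideanSpace ℝ (Fin n))).toSphere

/-- Convex bodies in `ℝⁿ` containing the origin in their interiors, with the Hausdorff metric
(the metric that Mathlib puts on `ConvexBody`). -/
abbrev KO (n : ℕ) : Type :=
  {K : ConvexBody (EuclideanSpace ℝ (Fin n)) //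
    (0 : EuclideanSpace ℝ (Fin n)) ∈ interior (K : Set (EuclideanSpace ℝ (Fin n)))}

variable {n : ℕ}

/-- `Φ(t, u) = ∫_t^∞ φ(r u) r^{n-1} dr`. -/
noncomputable def Phi (φ : EuclideanSpace ℝ (Fin n) → ℝ) (t : ℝ) (u : Sph n) : ℝ :=
  ∫ r in Ioi t, φ (r • (u : EuclideanSpace ℝ (Fin n))) * r ^ (n - 1)

/-- Condition C1): `φ` is continuous and positive on `ℝⁿ \ {0}` (its value at `0` is irrelevant),
and for each `t > 0` the function `Φ(t, ·)` is finite, positive and continuous on the sphere. -/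
structure ConditionC1 (φ : EuclideanSpace ℝ (Fin n) → ℝ) : Prop where
  continuousOn : ContinuousOn φ {0}ᶜ
  pos : ∀ x, x ≠ 0 → 0 < φ x
  integrableOn : ∀ t : ℝ, 0 < t → ∀ u : Sph n,
    IntegrableOn (fun r : ℝ => φ (r • (u : EuclideanSpace ℝ (Fin n))) * r ^ (n - 1)) (Ioi t)
  Phi_pos : ∀ t : ℝ, 0 < t → ∀ u : Sph n, 0 < Phi φ t u
  Phi_continuous : ∀ t : ℝ, 0 < t → Continuous (fun u : Sph n => Phi φ t u)

/-- The radial function `ρ_K(u) = sup {λ > 0 : λ u ∈ K}`. -/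
noncomputable def radial (K : Set (EuclideanSpace ℝ (Fin n))) (u : Sph n) : ℝ :=
  sSup {l : ℝ | 0 < l ∧ l • (u : EuclideanSpace ℝ (Fin n)) ∈ K}

/-- The support function `h_K(u) = sup {⟨x, u⟩ : x ∈ K}`. -/
noncomputable def support (K : Set (EuclideanSpace ℝ (Fin n))) (u : Sph n) : ℝ :=
  sSup ((fun x => ⟪x, (u : EuclideanSpace ℝ (Fin n))⟫) '' K)

/-- The supporting hyperplane `H(K, u) = {x : ⟨x, u⟩ = h_K(u)}`. -/
def supportHyperplane (K : Set (EuclideanSpace ℝ (Fin n))) (u : Sph n) :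
    Set (EuclideanSpace ℝ (Fin n)) :=
  {x | ⟪x, (u : EuclideanSpace ℝ (Fin n))⟫ = support K u}

/-- The reverse radial Gauss image `α*_K(η) = {x/|x| : x ∈ ∂K ∩ H(K, u) for some u ∈ η}`. -/
def reverseRadialGaussImage (K : Set (EuclideanSpace ℝ (Fin n))) (η : Set (Sph n)) :
    Set (Sph n) :=
  {v | ∃ u ∈ η, ∃ x ∈ frontier K ∩ supportHyperplane K u,
    (v : EuclideanSpace ℝ (Fin n)) = ‖x‖⁻¹ • x}

/-- `Ψ_K(u) = φ(ρ_K(u) u) ρ_K(u)^n`. -/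
noncomputable def Psi (φ : EuclideanSpace ℝ (Fin n) → ℝ) (K : Set (EuclideanSpace ℝ (Fin n)))
    (u : Sph n) : ℝ :=
  φ (radial K u • (u : EuclideanSpace ℝ (Fin n))) * radial K u ^ n

/-- The value on `η` of the general dual Orlicz curvature measure of `K`, namely the integral of
`Ψ_K` over `α*_K(η)` with respect to the spherical measure. -/
noncomputable def curvatureValue (φ : EuclideanSpace ℝ (Fin n) → ℝ)
    (K : Set (EuclideanSpace ℝ (Fin n))) (η : Set (Sph n)) : ENNReal :=
  ∫⁻ u in reverseRadialGaussImage K η, ENNReal.ofReal (Psi φ K u) ∂(sphMeasure n)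

/-- `μ` is the finite Borel measure given by `η ↦ curvatureValue φ K η` on Borel sets; there is at
most one such `μ`. -/
def IsCurvatureMeasure (φ : EuclideanSpace ℝ (Fin n) → ℝ)
    (K : Set (EuclideanSpace ℝ (Fin n))) (μ : FiniteMeasure (Sph n)) : Prop :=
  ∀ η : Set (Sph n), MeasurableSet η → (μ : Measure (Sph n)) η = curvatureValue φ K η

open Classical in
/-- The general dual Orlicz curvature measure of `K`: the finite Borel measure with the values
`curvatureValue φ K η` on Borel sets (with the value `0` if that set function were not a finite
measure; see `IsCurvatureMeasure`). -/
noncomputable def curvatureMeasure (φ : EuclideanSpace ℝ (Fin n) → ℝ)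
    (K : Set (EuclideanSpace ℝ (Fin n))) : FiniteMeasure (Sph n) :=
  if h : ∃ μ : FiniteMeasure (Sph n), IsCurvatureMeasure φ K μ then h.choose else 0

end DualOrlicz

/-!
The measure is realised as a push-forward. Let `g` be the gauge of a body `K` with the origin in its
interior; then `ρ_K = 1 / g` on the sphere. The gauge is Lipschitz, so by Rademacher's theorem and
homogeneity it is differentiable at almost every direction `v` (`KO.ae_differentiableAt_gauge`).
At such a `v` the boundary point `v / g(v)` has exactly one outer unit normal, the normalised
gradient of `g` (`KO.isOuterNormal_unitNormal`, `KO.eq_unitNormal`). Hence `α*_K(η)` agrees up to a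
null set with the preimage of `η` under the measurable map `unitNormal`, and the curvature measure
is the image of the finite measure `Ψ_K(v) dv` under this map (`gaussPushforward_apply`).

For weak convergence, a test function is pulled back to the sphere of directions and dominated
convergence applies. A cancellation argument turns Hausdorff convergence into
`(1 - δ) g_i ≤ g ≤ (1 + δ) g_i` for large `i` (`eventually_gauge_comparable`). This bounds the
densities uniformly and makes them converge pointwise. The normals converge at almost every
direction because the sphere is compact, every cluster point of the normals is a normal of the
limit body, and that normal is unique (`tendsto_unitNormal`).
-/

namespace DualOrlicz

variable {n : ℕ}

/-! ### Gauge and radial function -/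

theorem KO.mem_nhds_zero (M : KO n) : (M.1 : Set (EuclideanSpace ℝ (Fin n))) ∈ 𝓝 0 :=
  mem_interior_iff_mem_nhds.1 M.2

theorem KO.continuous_gauge (M : KO n) :
    Continuous (gauge (M.1 : Set (EuclideanSpace ℝ (Fin n)))) :=
  _root_.continuous_gauge M.1.convex M.mem_nhds_zero

theorem KO.gauge_pos (M : KO n) {x : EuclideanSpace ℝ (Fin n)} (hx : x ≠ 0) :
    0 < gauge (M.1 : Set (EuclideanSpace ℝ (Fin n))) x :=
  (_root_.gauge_pos (absorbent_nhds_zero M.mem_nhds_zero)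
    (NormedSpace.isVonNBounded_of_isBounded ℝ M.1.isBounded)).2 hx

theorem sph_ne_zero (v : Sph n) : (v : EuclideanSpace ℝ (Fin n)) ≠ 0 :=
  ne_zero_of_mem_unit_sphere v

theorem KO.gauge_sph_pos (M : KO n) (v : Sph n) :
    0 < gauge (M.1 : Set (EuclideanSpace ℝ (Fin n))) v :=
  M.gauge_pos (sph_ne_zero v)

theorem KO.gauge_smul (M : KO n) {t : ℝ} (ht : 0 ≤ t) (x : EuclideanSpace ℝ (Fin n)) :
    gauge (M.1 : Set (EuclideanSpace ℝ (Fin n))) (t • x) = t * gauge (M.1 : Set _) x := by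
  rw [gauge_smul_of_nonneg ht, smul_eq_mul]

theorem KO.gauge_le_one_iff (M : KO n) {x : EuclideanSpace ℝ (Fin n)} :
    gauge (M.1 : Set (EuclideanSpace ℝ (Fin n))) x ≤ 1 ↔ x ∈ (M.1 : Set _) := by
  rw [gauge_le_one_iff_mem_closure M.1.convex M.mem_nhds_zero, M.1.isClosed.closure_eq]

/-- A bound for the gauge of `M` on a body `N` extends, by homogeneity, to the whole space. -/
theorem KO.gauge_le_mul_gauge (M N : KO n) {c : ℝ}
    (h : ∀ x ∈ (N.1 : Set (EuclideanSpace ℝ (Fin n))), gauge (M.1 : Set _) x ≤ c)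
    (x : EuclideanSpace ℝ (Fin n)) :
    gauge (M.1 : Set (EuclideanSpace ℝ (Fin n))) x ≤ c * gauge (N.1 : Set _) x := by
  rcases eq_or_ne x 0 with rfl | hx
  · simp
  have hp := N.gauge_pos hx
  have hmem : (gauge (N.1 : Set (EuclideanSpace ℝ (Fin n))) x)⁻¹ • x ∈ (N.1 : Set _) := by
    rw [← N.gauge_le_one_iff, N.gauge_smul (inv_nonneg.2 hp.le), inv_mul_cancel₀ hp.ne']
  have := h _ hmem
  rwa [M.gauge_smul (inv_nonneg.2 hp.le), inv_mul_le_iff₀ hp, mul_comm] at this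

theorem KO.radial_eq_inv_gauge (M : KO n) (v : Sph n) :
    radial (M.1 : Set (EuclideanSpace ℝ (Fin n))) v =
      (gauge (M.1 : Set (EuclideanSpace ℝ (Fin n))) v)⁻¹ := by
  have hp := M.gauge_sph_pos v
  have : {l : ℝ | 0 < l ∧ l • (v : EuclideanSpace ℝ (Fin n)) ∈ (M.1 : Set _)}
      = Ioc 0 (gauge (M.1 : Set (EuclideanSpace ℝ (Fin n))) v)⁻¹ := by
    ext l
    simp only [mem_ofPred_eq, mem_Ioc]
    refine and_congr_right fun hl => ?_
    rw [← M.gauge_le_one_iff, M.gauge_smul hl.le, ← le_div_iff₀ hp, one_div]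
  rw [radial, this, csSup_Ioc (inv_pos.2 hp)]

/-! ### Outer normals and differentiability of the gauge -/

/-- `u` is an outer unit normal of `K` at its boundary point in direction `v`. The condition
`⟨y, u⟩ ≤ ⟨v, u⟩ / g(v)` on `y ∈ K`, where `g` is the gauge of `K`, is written in homogeneous form,
so that it only involves the values of the gauge and passes to pointwise limits of gauges. -/
def IsOuterNormal (K : Set (EuclideanSpace ℝ (Fin n))) (v u : Sph n) : Prop :=
  ∀ y : EuclideanSpace ℝ (Fin n), gauge K v * ⟪y, (u : EuclideanSpace ℝ (Fin n))⟫ ≤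
    ⟪(v : EuclideanSpace ℝ (Fin n)), (u : EuclideanSpace ℝ (Fin n))⟫ * gauge K y

theorem KO.mem_reverseRadialGaussImage (M : KO n) (η : Set (Sph n)) (v : Sph n) :
    v ∈ reverseRadialGaussImage (M.1 : Set (EuclideanSpace ℝ (Fin n))) η ↔
      ∃ u ∈ η, IsOuterNormal (M.1 : Set (EuclideanSpace ℝ (Fin n))) v u := by
  have hp := M.gauge_sph_pos v
  have hbdd : ∀ u : Sph n, BddAbove ((fun x => ⟪x, (u : EuclideanSpace ℝ (Fin n))⟫) ''
      (M.1 : Set (EuclideanSpace ℝ (Fin n)))) := fun u =>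
    (M.1.isCompact.image (by fun_prop)).bddAbove
  constructor
  · rintro ⟨u, hu, x, ⟨hxf, hxu⟩, hv⟩
    refine ⟨u, hu, fun y => ?_⟩
    rw [← gauge_eq_one_iff_mem_frontier M.1.convex M.mem_nhds_zero] at hxf
    have hx0 : x ≠ 0 := by
      rintro rfl
      simp at hxf
    have hxn : 0 < ‖x‖⁻¹ := inv_pos.2 (norm_pos_iff.2 hx0)
    rw [hv, M.gauge_smul hxn.le, hxf, mul_one, real_inner_smul_left, mul_assoc]
    refine mul_le_mul_of_nonneg_left ?_ hxn.le
    rcases eq_or_ne y 0 with rfl | hy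
    · simp
    have hyp := M.gauge_pos hy
    have hmem : (gauge (M.1 : Set (EuclideanSpace ℝ (Fin n))) y)⁻¹ • y ∈ (M.1 : Set _) := by
      rw [← M.gauge_le_one_iff, M.gauge_smul (inv_nonneg.2 hyp.le), inv_mul_cancel₀ hyp.ne']
    have h1 := le_csSup (hbdd u) (mem_image_of_mem _ hmem)
    have h2 : ⟪x, (u : EuclideanSpace ℝ (Fin n))⟫ = support _ u := hxu
    rw [support] at h2
    simp only [← h2, real_inner_smul_left] at h1
    rwa [inv_mul_le_iff₀ hyp, mul_comm] at h1
  · rintro ⟨u, hu, h⟩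
    set g := gauge (M.1 : Set (EuclideanSpace ℝ (Fin n))) v with hg
    have hgx : gauge (M.1 : Set (EuclideanSpace ℝ (Fin n)))
        (g⁻¹ • (v : EuclideanSpace ℝ (Fin n))) = 1 := by
      rw [M.gauge_smul (inv_nonneg.2 hp.le), ← hg, inv_mul_cancel₀ hp.ne']
    have hmem := M.gauge_le_one_iff.1 hgx.le
    have hle : ∀ y ∈ (M.1 : Set (EuclideanSpace ℝ (Fin n))),
        ⟪y, (u : EuclideanSpace ℝ (Fin n))⟫ ≤
          ⟪g⁻¹ • (v : EuclideanSpace ℝ (Fin n)), (u : EuclideanSpace ℝ (Fin n))⟫ := by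
      intro y hy
      have hvu : 0 ≤ ⟪(v : EuclideanSpace ℝ (Fin n)), (u : EuclideanSpace ℝ (Fin n))⟫ := by
        -- test the normal inequality at `u` itself
        have h1 := h u
        have h2 : (0 : ℝ) < ⟪(u : EuclideanSpace ℝ (Fin n)), (u : EuclideanSpace ℝ (Fin n))⟫ :=
          real_inner_self_pos.2 (sph_ne_zero u)
        exact (pos_of_mul_pos_left ((mul_pos hp h2).trans_le h1) (gauge_nonneg _)).le
      rw [real_inner_smul_left, ← div_eq_inv_mul, le_div_iff₀ hp, mul_comm]
      exact (h y).trans (mul_le_of_le_one_right hvu (M.gauge_le_one_iff.2 hy))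
    refine ⟨u, hu, g⁻¹ • (v : EuclideanSpace ℝ (Fin n)), ⟨?_, ?_⟩, ?_⟩
    · rwa [← gauge_eq_one_iff_mem_frontier M.1.convex M.mem_nhds_zero]
    · refine le_antisymm (le_csSup (hbdd u) (mem_image_of_mem _ hmem)) (csSup_le ?_ ?_)
      · exact ⟨_, mem_image_of_mem _ hmem⟩
      · rintro _ ⟨y, hy, rfl⟩
        exact hle y hy
    · rw [norm_smul, norm_inv, Real.norm_of_nonneg hp.le, norm_eq_of_mem_sphere v, mul_one, inv_inv,
        smul_smul, mul_inv_cancel₀ hp.ne', one_smul]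

/-- The normalised gradient of the gauge of `K` at `v`; the value `v` for a vanishing gradient is
arbitrary. -/
noncomputable def unitNormal (K : Set (EuclideanSpace ℝ (Fin n))) (v : Sph n) : Sph n :=
  ⟨if gradient (gauge K) (v : EuclideanSpace ℝ (Fin n)) = 0 then (v : EuclideanSpace ℝ (Fin n))
    else ‖gradient (gauge K) (v : EuclideanSpace ℝ (Fin n))‖⁻¹ • gradient (gauge K) v, by
    split_ifs with h
    · exact v.2
    · simp [norm_smul, h]⟩

theorem measurable_unitNormal (K : Set (EuclideanSpace ℝ (Fin n))) :
    Measurable (unitNormal K) := by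
  have hgrad : Measurable fun v : Sph n =>
      gradient (gauge K) (v : EuclideanSpace ℝ (Fin n)) :=
    ((InnerProductSpace.toDual ℝ (EuclideanSpace ℝ (Fin n))).symm.continuous.measurable.comp
      (measurable_fderiv ℝ (gauge K))).comp measurable_subtype_coe
  exact (Measurable.ite (hgrad (measurableSet_singleton 0)) measurable_subtype_coe
    (hgrad.norm.inv.smul hgrad)).subtype_mk

/-- The gradient of the gauge at a point of differentiability is a subgradient at `0`, with equality
in direction `v`, by sublinearity. -/
theorem KO.fderiv_gauge_le (M : KO n) {v : EuclideanSpace ℝ (Fin n)}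
    (hd : DifferentiableAt ℝ (gauge (M.1 : Set (EuclideanSpace ℝ (Fin n)))) v)
    (y : EuclideanSpace ℝ (Fin n)) :
    fderiv ℝ (gauge (M.1 : Set (EuclideanSpace ℝ (Fin n)))) v y ≤ gauge (M.1 : Set _) y := by
  have hline := (hd.hasFDerivAt.hasLineDerivAt y).tendsto_slope_zero_right
  refine le_of_tendsto hline ?_
  filter_upwards [self_mem_nhdsWithin] with t (ht : 0 < t)
  have := gauge_add_le M.1.convex (absorbent_nhds_zero M.mem_nhds_zero) v (t • y)
  rw [M.gauge_smul ht.le] at this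
  rw [smul_eq_mul, inv_mul_le_iff₀ ht]
  linarith

theorem KO.fderiv_gauge_self (M : KO n) {v : EuclideanSpace ℝ (Fin n)}
    (hd : DifferentiableAt ℝ (gauge (M.1 : Set (EuclideanSpace ℝ (Fin n)))) v) :
    fderiv ℝ (gauge (M.1 : Set (EuclideanSpace ℝ (Fin n)))) v v = gauge (M.1 : Set _) v := by
  have hline := (hd.hasFDerivAt.hasLineDerivAt v).tendsto_slope_zero_right
  refine tendsto_nhds_unique (hline.congr' ?_) tendsto_const_nhds
  filter_upwards [self_mem_nhdsWithin] with t (ht : 0 < t)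
  have : v + t • v = (1 + t) • v := by rw [add_smul, one_smul]
  rw [this, M.gauge_smul (by positivity), smul_eq_mul]
  field_simp
  ring

theorem KO.gradient_gauge_ne_zero (M : KO n) {v : Sph n}
    (hd : DifferentiableAt ℝ (gauge (M.1 : Set (EuclideanSpace ℝ (Fin n)))) v) :
    gradient (gauge (M.1 : Set (EuclideanSpace ℝ (Fin n)))) v ≠ 0 := by
  intro h
  have h1 := M.fderiv_gauge_self hd
  rw [gradient, LinearIsometryEquiv.map_eq_zero_iff] at h
  rw [h] at h1
  exact (M.gauge_sph_pos v).ne h1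

theorem inner_gradient (f : EuclideanSpace ℝ (Fin n) → ℝ) (x y : EuclideanSpace ℝ (Fin n)) :
    ⟪y, gradient f x⟫ = fderiv ℝ f x y := by
  rw [real_inner_comm, gradient, InnerProductSpace.toDual_symm_apply]

theorem KO.isOuterNormal_unitNormal (M : KO n) {v : Sph n}
    (hd : DifferentiableAt ℝ (gauge (M.1 : Set (EuclideanSpace ℝ (Fin n)))) v) :
    IsOuterNormal (M.1 : Set (EuclideanSpace ℝ (Fin n))) v (unitNormal (M.1 : Set _) v) := by
  intro y
  have h0 := M.gradient_gauge_ne_zero hd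
  simp only [unitNormal, if_neg h0, real_inner_smul_right, inner_gradient,
    M.fderiv_gauge_self hd]
  have h1 : 0 ≤ ‖gradient (gauge (M.1 : Set (EuclideanSpace ℝ (Fin n)))) v‖⁻¹ *
      gauge (M.1 : Set (EuclideanSpace ℝ (Fin n))) v :=
    mul_nonneg (inv_nonneg.2 (norm_nonneg _)) (gauge_nonneg _)
  calc _ = (‖gradient (gauge (M.1 : Set (EuclideanSpace ℝ (Fin n)))) v‖⁻¹ *
      gauge (M.1 : Set (EuclideanSpace ℝ (Fin n))) v) * _ := by ring
    _ ≤ _ := mul_le_mul_of_nonneg_left (M.fderiv_gauge_le hd y) h1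

/-- Where the gauge is differentiable, the outer unit normal is unique: for a normal `u` the function
`y ↦ ⟨v, u⟩ g(y) - g(v) ⟨y, u⟩` is minimal at `v`, so its derivative vanishes there and `u` is a
positive multiple of the gradient of the gauge. -/
theorem KO.eq_unitNormal (M : KO n) {v u : Sph n}
    (hd : DifferentiableAt ℝ (gauge (M.1 : Set (EuclideanSpace ℝ (Fin n)))) v)
    (hu : IsOuterNormal (M.1 : Set (EuclideanSpace ℝ (Fin n))) v u) :
    u = unitNormal (M.1 : Set (EuclideanSpace ℝ (Fin n))) v := by
  have hp := M.gauge_sph_pos v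
  have h0 := M.gradient_gauge_ne_zero hd
  set g := gauge (M.1 : Set (EuclideanSpace ℝ (Fin n))) with hg
  set a : ℝ := ⟪(v : EuclideanSpace ℝ (Fin n)), (u : EuclideanSpace ℝ (Fin n))⟫ with ha
  have ha0 : 0 < a := by
    have h2 : (0 : ℝ) < ⟪(u : EuclideanSpace ℝ (Fin n)), (u : EuclideanSpace ℝ (Fin n))⟫ :=
      real_inner_self_pos.2 (sph_ne_zero u)
    exact pos_of_mul_pos_left ((mul_pos hp h2).trans_le (hu u)) (gauge_nonneg _)
  have hmin : IsLocalMin (fun y : EuclideanSpace ℝ (Fin n) =>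
      a * g y - g v * innerSL ℝ (u : EuclideanSpace ℝ (Fin n)) y) v := by
    refine Eventually.of_forall fun y => ?_
    have := hu y
    simp only [innerSL_apply_apply, real_inner_comm _ (u : EuclideanSpace ℝ (Fin n))] at this ⊢
    rw [← hg] at this
    linarith
  have hder : HasFDerivAt (fun y : EuclideanSpace ℝ (Fin n) =>
      a * g y - g v * innerSL ℝ (u : EuclideanSpace ℝ (Fin n)) y)
      (a • fderiv ℝ g v - g v • innerSL ℝ (u : EuclideanSpace ℝ (Fin n))) v :=
    (hd.hasFDerivAt.const_mul a).sub
      ((innerSL ℝ (u : EuclideanSpace ℝ (Fin n))).hasFDerivAt.const_mul _)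
  have hz := hmin.hasFDerivAt_eq_zero hder
  have hgrad : gradient g (v : EuclideanSpace ℝ (Fin n)) =
      (a⁻¹ * g v) • (u : EuclideanSpace ℝ (Fin n)) := by
    refine ext_inner_left ℝ fun y => ?_
    have h3 := congrArg (fun L => L y) hz
    simp only [sub_apply, smul_apply, smul_eq_mul,
      innerSL_apply_apply, zero_apply] at h3
    rw [inner_gradient, real_inner_smul_right, real_inner_comm]
    field_simp
    linarith
  have hc : 0 < a⁻¹ * g v := mul_pos (inv_pos.2 ha0) hp
  ext1
  simp only [unitNormal, ← hg, if_neg h0]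
  rw [hgrad, norm_smul, norm_eq_of_mem_sphere u, Real.norm_of_nonneg hc.le, mul_one, smul_smul,
    inv_mul_cancel₀ hc.ne', one_smul]

/-- Rademacher's theorem on the sphere: the set where the gauge is not differentiable is a null cone,
and the spherical measure of a set is computed from the volume of the cone over it. -/
theorem KO.ae_differentiableAt_gauge (M : KO n) :
    ∀ᵐ v : Sph n ∂(sphMeasure n),
      DifferentiableAt ℝ (gauge (M.1 : Set (EuclideanSpace ℝ (Fin n)))) v := by
  obtain ⟨C, hC⟩ := M.1.convex.lipschitz_gauge M.mem_nhds_zero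
  have hae : ∀ᵐ x : EuclideanSpace ℝ (Fin n),
      DifferentiableAt ℝ (gauge (M.1 : Set (EuclideanSpace ℝ (Fin n)))) x :=
    hC.ae_differentiableAt
  have hm : MeasurableSet {v : Sph n |
      ¬ DifferentiableAt ℝ (gauge (M.1 : Set (EuclideanSpace ℝ (Fin n)))) v} :=
    measurable_subtype_coe (measurableSet_of_differentiableAt ℝ
      (gauge (M.1 : Set (EuclideanSpace ℝ (Fin n))))).compl
  rw [ae_iff, Measure.toSphere_apply' _ hm]
  refine mul_eq_zero_of_right _ (measure_mono_null ?_ (ae_iff.1 hae))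
  rintro _ ⟨t, ht, _, ⟨v, hv, rfl⟩, rfl⟩ hd
  refine hv ?_
  have h1 : gauge (M.1 : Set (EuclideanSpace ℝ (Fin n))) = fun x =>
      t⁻¹ * gauge (M.1 : Set (EuclideanSpace ℝ (Fin n))) (t • x) := by
    funext x
    rw [M.gauge_smul ht.1.le, inv_mul_cancel_left₀ ht.1.ne']
  rw [h1]
  exact (DifferentiableAt.comp (v : EuclideanSpace ℝ (Fin n)) hd
    (differentiableAt_id.const_smul t)).const_mul _

/-! ### The curvature measure as a push-forward -/

/-- At `(c, v)` the function below is the value `Ψ(v)` of any body whose gauge at `v` is `c` times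
that of `M`. The parameter `c` gives bounds for `Ψ` that are uniform over nearby bodies. -/
theorem continuousOn_density {φ : EuclideanSpace ℝ (Fin n) → ℝ} (hφ : ConditionC1 φ) (M : KO n) :
    ContinuousOn (fun p : ℝ × Sph n =>
      φ ((p.1 * gauge (M.1 : Set (EuclideanSpace ℝ (Fin n))) p.2)⁻¹ •
        (p.2 : EuclideanSpace ℝ (Fin n))) *
      (p.1 * gauge (M.1 : Set (EuclideanSpace ℝ (Fin n))) p.2)⁻¹ ^ n) (Ioi 0 ×ˢ univ) := by
  have hpos : ∀ p ∈ (Ioi (0 : ℝ) ×ˢ (univ : Set (Sph n))),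
      0 < p.1 * gauge (M.1 : Set (EuclideanSpace ℝ (Fin n))) p.2 := fun p hp =>
    mul_pos hp.1 (M.gauge_sph_pos _)
  have hg := M.continuous_gauge
  have hinv : ContinuousOn (fun p : ℝ × Sph n =>
      (p.1 * gauge (M.1 : Set (EuclideanSpace ℝ (Fin n))) p.2)⁻¹) (Ioi 0 ×ˢ univ) :=
    ContinuousOn.inv₀ (by fun_prop) fun p hp => (hpos p hp).ne'
  refine ContinuousOn.mul ?_ (hinv.pow n)
  refine hφ.continuousOn.comp (hinv.smul (by fun_prop)) fun p hp => ?_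
  exact smul_ne_zero (inv_pos.2 (hpos p hp)).ne' (sph_ne_zero _)

theorem continuous_Psi {φ : EuclideanSpace ℝ (Fin n) → ℝ} (hφ : ConditionC1 φ) (M : KO n) :
    Continuous (Psi φ (M.1 : Set (EuclideanSpace ℝ (Fin n)))) := by
  have h := (continuousOn_density hφ M).comp_continuous
    (f := fun v : Sph n => ((1 : ℝ), v)) (by fun_prop) fun v => ⟨one_pos (α := ℝ), mem_univ v⟩
  refine h.congr fun v => ?_
  simp [Psi, M.radial_eq_inv_gauge]

theorem Psi_nonneg {φ : EuclideanSpace ℝ (Fin n) → ℝ} (hφ : ConditionC1 φ) (M : KO n) (v : Sph n) :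
    0 ≤ Psi φ (M.1 : Set (EuclideanSpace ℝ (Fin n))) v := by
  have h := inv_pos.2 (M.gauge_sph_pos v)
  rw [Psi, M.radial_eq_inv_gauge]
  exact mul_nonneg (hφ.pos _ (smul_ne_zero h.ne' (sph_ne_zero v))).le (pow_nonneg h.le n)

/-- The image of `Ψ_K du` under the almost everywhere defined Gauss map. -/
noncomputable def gaussPushforward (φ : EuclideanSpace ℝ (Fin n) → ℝ)
    (K : Set (EuclideanSpace ℝ (Fin n))) : Measure (Sph n) :=
  ((sphMeasure n).withDensity fun v => ENNReal.ofReal (Psi φ K v)).map (unitNormal K)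

theorem integrable_Psi {φ : EuclideanSpace ℝ (Fin n) → ℝ} (hφ : ConditionC1 φ) (M : KO n) :
    Integrable (Psi φ (M.1 : Set (EuclideanSpace ℝ (Fin n)))) (sphMeasure n) :=
  (continuous_Psi hφ M).integrable_of_hasCompactSupport (HasCompactSupport.of_compactSpace _)

theorem isFiniteMeasure_gaussPushforward {φ : EuclideanSpace ℝ (Fin n) → ℝ} (hφ : ConditionC1 φ)
    (M : KO n) : IsFiniteMeasure (gaussPushforward φ (M.1 : Set (EuclideanSpace ℝ (Fin n)))) := by
  have := isFiniteMeasure_withDensity_ofReal (integrable_Psi hφ M).2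
  exact Measure.isFiniteMeasure_map _ _

/-- Up to the null set where the gauge is not differentiable, the reverse radial Gauss image of `η`
is the preimage of `η` under the Gauss map. -/
theorem gaussPushforward_apply (φ : EuclideanSpace ℝ (Fin n) → ℝ) (M : KO n)
    {η : Set (Sph n)} (hη : MeasurableSet η) :
    gaussPushforward φ (M.1 : Set (EuclideanSpace ℝ (Fin n))) η =
      curvatureValue φ (M.1 : Set (EuclideanSpace ℝ (Fin n))) η := by
  have hm := measurable_unitNormal (M.1 : Set (EuclideanSpace ℝ (Fin n)))
  rw [gaussPushforward, Measure.map_apply hm hη, withDensity_apply _ (hm hη), curvatureValue]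
  refine setLIntegral_congr ?_
  filter_upwards [M.ae_differentiableAt_gauge] with v hv
  refine propext (Iff.trans ?_ (M.mem_reverseRadialGaussImage η v).symm)
  constructor
  · exact fun h => ⟨_, h, M.isOuterNormal_unitNormal hv⟩
  · rintro ⟨u, hu, hn⟩
    rw [M.eq_unitNormal hv hn] at hu
    exact hu

theorem isCurvatureMeasure_curvatureMeasure {φ : EuclideanSpace ℝ (Fin n) → ℝ}
    (hφ : ConditionC1 φ) (M : KO n) :
    IsCurvatureMeasure φ (M.1 : Set (EuclideanSpace ℝ (Fin n)))
      (curvatureMeasure φ (M.1 : Set (EuclideanSpace ℝ (Fin n)))) := by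
  have h : ∃ μ : FiniteMeasure (Sph n),
      IsCurvatureMeasure φ (M.1 : Set (EuclideanSpace ℝ (Fin n))) μ :=
    ⟨⟨_, isFiniteMeasure_gaussPushforward hφ M⟩, fun η hη => gaussPushforward_apply φ M hη⟩
  rw [curvatureMeasure, dif_pos h]
  exact h.choose_spec

theorem coe_curvatureMeasure {φ : EuclideanSpace ℝ (Fin n) → ℝ} (hφ : ConditionC1 φ) (M : KO n) :
    (curvatureMeasure φ (M.1 : Set (EuclideanSpace ℝ (Fin n))) : Measure (Sph n)) =
      gaussPushforward φ (M.1 : Set (EuclideanSpace ℝ (Fin n))) :=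
  Measure.ext fun η hη => by
    rw [isCurvatureMeasure_curvatureMeasure hφ M η hη, gaussPushforward_apply φ M hη]

theorem integral_curvatureMeasure {φ : EuclideanSpace ℝ (Fin n) → ℝ} (hφ : ConditionC1 φ)
    (M : KO n) {f : Sph n → ℝ} (hf : Continuous f) :
    ∫ u, f u ∂(curvatureMeasure φ (M.1 : Set (EuclideanSpace ℝ (Fin n))) : Measure (Sph n)) =
      ∫ v, Psi φ (M.1 : Set (EuclideanSpace ℝ (Fin n))) v *
        f (unitNormal (M.1 : Set (EuclideanSpace ℝ (Fin n))) v) ∂(sphMeasure n) := by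
  rw [coe_curvatureMeasure hφ, gaussPushforward,
    integral_map (measurable_unitNormal _).aemeasurable hf.measurable.aestronglyMeasurable,
    integral_withDensity_eq_integral_toReal_smul
      (continuous_Psi hφ M).measurable.ennreal_ofReal (by simp)]
  simp only [ENNReal.toReal_ofReal (Psi_nonneg hφ M _), smul_eq_mul]

/-! ### Hausdorff convergence and convergence of gauges -/

/-- Cancellation for convex sets: if `K ⊆ s + δ K` with `K` compact and `s` closed and convex, then
`(1 - δ) K ⊆ s`. Otherwise a functional strictly separates some `(1 - δ) k` from `s`, and evaluating
the inclusion at a maximiser of this functional on `K` is contradictory. -/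
theorem smul_mem_of_subset_add_smul {E : Type*} [NormedAddCommGroup E] [NormedSpace ℝ E]
    {s K : Set E} (hs : Convex ℝ s) (hsc : IsClosed s) (hK : IsCompact K) {δ : ℝ}
    (hδ0 : 0 ≤ δ) (hδ1 : δ ≤ 1) (h : ∀ x ∈ K, ∃ y ∈ s, ∃ z ∈ K, x = y + δ • z) {x : E}
    (hx : x ∈ K) : (1 - δ) • x ∈ s := by
  by_contra hns
  obtain ⟨f, u, hfs, hfx⟩ := geometric_hahn_banach_closed_point hs hsc hns
  obtain ⟨m, hm, hmax⟩ := hK.exists_isMaxOn ⟨x, hx⟩ f.continuous.continuousOn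
  obtain ⟨y, hy, z, hz, hmz⟩ := h m hm
  have h1 := hfs y hy
  have h2 : f m = f y + δ * f z := by rw [hmz]; simp
  have h3 : f z ≤ f m := hmax hz
  have h4 : f x ≤ f m := hmax hx
  have h5 : u < (1 - δ) * f x := by simpa using hfx
  nlinarith [mul_le_mul_of_nonneg_left h3 hδ0, mul_le_mul_of_nonneg_left h4 (sub_nonneg.2 hδ1)]

/-- Hausdorff convergence makes the gauges asymptotically comparable. -/
theorem eventually_gauge_comparable {K : ℕ → KO n} {L : KO n} (hK : Tendsto K atTop (𝓝 L))
    {δ : ℝ} (hδ0 : 0 < δ) (hδ1 : δ < 1) :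
    ∀ᶠ i in atTop, ∀ x : EuclideanSpace ℝ (Fin n),
      (1 - δ) * gauge ((K i).1 : Set (EuclideanSpace ℝ (Fin n))) x ≤ gauge (L.1 : Set _) x ∧
      gauge (L.1 : Set (EuclideanSpace ℝ (Fin n))) x ≤
        (1 + δ) * gauge ((K i).1 : Set (EuclideanSpace ℝ (Fin n))) x := by
  obtain ⟨r, hr, hball⟩ := Metric.mem_nhds_iff.1 L.mem_nhds_zero
  filter_upwards [Metric.tendsto_nhds.1 hK (δ * r) (by positivity)] with i hi
  have hdist : Metric.hausdorffDist ((K i).1 : Set (EuclideanSpace ℝ (Fin n))) L.1 < δ * r := by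
    rwa [ConvexBody.hausdorffDist_coe, ← Subtype.dist_eq]
  -- differences of length less than `δ r` lie in `δ L`
  have hsmall : ∀ w : EuclideanSpace ℝ (Fin n), ‖w‖ < δ * r →
      δ⁻¹ • w ∈ (L.1 : Set (EuclideanSpace ℝ (Fin n))) := by
    intro w hw
    refine hball ?_
    rw [mem_ball_zero_iff, norm_smul, norm_inv, Real.norm_of_nonneg hδ0.le, inv_mul_lt_iff₀ hδ0]
    exact hw
  intro x
  constructor
  · rw [← (K i).gauge_smul (sub_nonneg.2 hδ1.le)]
    have := (K i).gauge_le_mul_gauge L (c := (1 - δ)⁻¹) (fun y hy => ?_) x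
    · rw [(K i).gauge_smul (sub_nonneg.2 hδ1.le)]
      rwa [← inv_mul_le_iff₀ (inv_pos.2 (sub_pos.2 hδ1)), inv_inv] at this
    have hmem : (1 - δ) • y ∈ ((K i).1 : Set (EuclideanSpace ℝ (Fin n))) := by
      refine smul_mem_of_subset_add_smul (K i).1.convex (K i).1.isClosed L.1.isCompact hδ0.le hδ1.le
        (fun w hw => ?_) hy
      obtain ⟨z, hz, hwz⟩ := Metric.exists_dist_lt_of_hausdorffDist_lt' hw hdist
        ConvexBody.hausdorffEDist_ne_top
      refine ⟨z, hz, δ⁻¹ • (w - z), hsmall _ ?_, ?_⟩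
      · rwa [← dist_eq_norm, dist_comm]
      · rw [smul_inv_smul₀ hδ0.ne']
        abel
    rw [← (K i).gauge_le_one_iff, (K i).gauge_smul (sub_nonneg.2 hδ1.le)] at hmem
    rwa [← one_div, le_div_iff₀ (sub_pos.2 hδ1), mul_comm]
  · refine L.gauge_le_mul_gauge (K i) (fun y hy => ?_) x
    obtain ⟨z, hz, hyz⟩ := Metric.exists_dist_lt_of_hausdorffDist_lt hy hdist
      ConvexBody.hausdorffEDist_ne_top
    have h1 := L.gauge_le_one_iff.2 (hsmall (y - z) (by rwa [← dist_eq_norm]))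
    rw [L.gauge_smul (inv_nonneg.2 hδ0.le), inv_mul_le_iff₀ hδ0, mul_one] at h1
    have h2 := gauge_add_le L.1.convex (absorbent_nhds_zero L.mem_nhds_zero) z (y - z)
    rw [add_sub_cancel] at h2
    linarith [L.gauge_le_one_iff.2 hz]

theorem tendsto_gauge {K : ℕ → KO n} {L : KO n} (hK : Tendsto K atTop (𝓝 L))
    (x : EuclideanSpace ℝ (Fin n)) :
    Tendsto (fun i => gauge ((K i).1 : Set (EuclideanSpace ℝ (Fin n))) x) atTop
      (𝓝 (gauge (L.1 : Set (EuclideanSpace ℝ (Fin n))) x)) := by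
  rcases eq_or_ne x 0 with rfl | hx
  · simp
  have hp := L.gauge_pos hx
  set g := gauge (L.1 : Set (EuclideanSpace ℝ (Fin n))) x
  refine Metric.tendsto_nhds.2 fun ε hε => ?_
  -- by comparability with constant `δ ≤ 1/2`, the error is at most `2 δ g`
  obtain ⟨δ, hδ0, hδ⟩ : ∃ δ : ℝ, 0 < δ ∧ δ < min (1 / 2) (ε / (2 * g)) := exists_between (by positivity)
  have hδ1 : δ < 1 / 2 := hδ.trans_le (min_le_left _ _)
  have hδ2 : δ * (2 * g) < ε := (lt_div_iff₀ (by positivity)).1 (hδ.trans_le (min_le_right _ _))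
  filter_upwards [eventually_gauge_comparable hK hδ0 (by linarith)] with i hi
  obtain ⟨h1, h2⟩ := hi x
  set a := gauge ((K i).1 : Set (EuclideanSpace ℝ (Fin n))) x
  change (1 - δ) * a ≤ g at h1
  change g ≤ (1 + δ) * a at h2
  have ha : 0 ≤ a := gauge_nonneg _
  have ha2 : a ≤ 2 * g := by nlinarith
  have := mul_le_mul_of_nonneg_left ha2 hδ0.le
  rw [Real.dist_eq, abs_lt]
  constructor <;> nlinarith

/-! ### Weak convergence -/

/-- Every cluster point of the normals of the approximating bodies is a normal of the limit body, and
that normal is unique. -/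
theorem tendsto_unitNormal {K : ℕ → KO n} {L : KO n} (hK : Tendsto K atTop (𝓝 L)) {v : Sph n}
    (hd : ∀ i, DifferentiableAt ℝ (gauge ((K i).1 : Set (EuclideanSpace ℝ (Fin n)))) v)
    (hL : DifferentiableAt ℝ (gauge (L.1 : Set (EuclideanSpace ℝ (Fin n)))) v) :
    Tendsto (fun i => unitNormal ((K i).1 : Set (EuclideanSpace ℝ (Fin n))) v) atTop
      (𝓝 (unitNormal (L.1 : Set (EuclideanSpace ℝ (Fin n))) v)) := by
  refine tendsto_nhds_of_unique_mapClusterPt fun u hu => L.eq_unitNormal hL fun y => ?_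
  obtain ⟨U, hU, hUu⟩ := mapClusterPt_iff_ultrafilter.1 hu
  have hUu' := (continuous_subtype_val.tendsto u).comp hUu
  exact le_of_tendsto_of_tendsto
    (((tendsto_gauge hK v).mono_left hU).mul (tendsto_const_nhds.inner hUu'))
    ((tendsto_const_nhds.inner hUu').mul ((tendsto_gauge hK y).mono_left hU))
    (Eventually.of_forall fun i => (K i).isOuterNormal_unitNormal (hd i) y)

theorem tendsto_Psi {φ : EuclideanSpace ℝ (Fin n) → ℝ} (hφ : ConditionC1 φ) {K : ℕ → KO n}
    {L : KO n} (hK : Tendsto K atTop (𝓝 L)) (v : Sph n) :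
    Tendsto (fun i => Psi φ ((K i).1 : Set (EuclideanSpace ℝ (Fin n))) v) atTop
      (𝓝 (Psi φ (L.1 : Set (EuclideanSpace ℝ (Fin n))) v)) := by
  have hp := inv_pos.2 (L.gauge_sph_pos v)
  have hinv := (tendsto_gauge hK v).inv₀ (L.gauge_sph_pos v).ne'
  have hne : (gauge (L.1 : Set (EuclideanSpace ℝ (Fin n))) v)⁻¹ •
      (v : EuclideanSpace ℝ (Fin n)) ≠ 0 := smul_ne_zero hp.ne' (sph_ne_zero v)
  simp only [Psi, KO.radial_eq_inv_gauge]
  refine Tendsto.mul ?_ (hinv.pow n)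
  exact (hφ.continuousOn.continuousAt (isOpen_compl_singleton.mem_nhds hne)).tendsto.comp
    (hinv.smul_const _)

theorem eventually_Psi_le {φ : EuclideanSpace ℝ (Fin n) → ℝ} (hφ : ConditionC1 φ) {K : ℕ → KO n}
    {L : KO n} (hK : Tendsto K atTop (𝓝 L)) :
    ∃ C : ℝ, ∀ᶠ i in atTop, ∀ v : Sph n,
      ‖Psi φ ((K i).1 : Set (EuclideanSpace ℝ (Fin n))) v‖ ≤ C := by
  have hsub : Icc (1 / 2 : ℝ) 2 ×ˢ (univ : Set (Sph n)) ⊆ Ioi 0 ×ˢ univ :=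
    prod_mono (fun c hc => lt_of_lt_of_le (by norm_num) hc.1) subset_rfl
  obtain ⟨C, hC⟩ := (isCompact_Icc.prod isCompact_univ).exists_bound_of_continuousOn
    ((continuousOn_density hφ L).mono hsub)
  refine ⟨C, ?_⟩
  filter_upwards [eventually_gauge_comparable hK (δ := 1 / 2) (by norm_num) (by norm_num)]
    with i hi v
  obtain ⟨h1, h2⟩ := hi v
  have hp := L.gauge_sph_pos v
  -- the ratio of the gauges lies in `[1/2, 2]`
  have h := hC (gauge ((K i).1 : Set (EuclideanSpace ℝ (Fin n))) v /
    gauge (L.1 : Set (EuclideanSpace ℝ (Fin n))) v, v)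
    ⟨⟨by rw [le_div_iff₀ hp]; linarith [(K i).gauge_sph_pos v], by
      rw [div_le_iff₀ hp]; linarith⟩, mem_univ _⟩
  simpa only [Psi, KO.radial_eq_inv_gauge, div_mul_cancel₀ _ hp.ne'] using h

theorem tendsto_curvatureMeasure {φ : EuclideanSpace ℝ (Fin n) → ℝ} (hφ : ConditionC1 φ)
    {K : ℕ → KO n} {L : KO n} (hK : Tendsto K atTop (𝓝 L)) :
    Tendsto (fun i => curvatureMeasure φ ((K i).1 : Set (EuclideanSpace ℝ (Fin n)))) atTop
      (𝓝 (curvatureMeasure φ (L.1 : Set (EuclideanSpace ℝ (Fin n))))) := by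
  refine FiniteMeasure.tendsto_iff_forall_integral_tendsto.2 fun f => ?_
  simp only [integral_curvatureMeasure hφ _ f.continuous]
  obtain ⟨C, hC⟩ := eventually_Psi_le hφ hK
  refine tendsto_integral_filter_of_dominated_convergence (fun _ => C * ‖f‖) ?_ ?_
    (integrable_const _) ?_
  · exact Eventually.of_forall fun i => ((continuous_Psi hφ (K i)).measurable.mul
      (f.continuous.measurable.comp (measurable_unitNormal _))).aestronglyMeasurable
  · filter_upwards [hC] with i hi
    refine Eventually.of_forall fun v => ?_
    rw [norm_mul]
    exact mul_le_mul (hi v) (f.norm_coe_le_norm _) (norm_nonneg _) ((norm_nonneg _).trans (hi v))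
  · filter_upwards [ae_all_iff.2 fun i => (K i).ae_differentiableAt_gauge,
      L.ae_differentiableAt_gauge] with v hv hvL
    exact (tendsto_Psi hφ hK v).mul ((f.continuous.tendsto _).comp (tendsto_unitNormal hK hv hvL))

end DualOrlicz

theorem proposition3p1 (n : ℕ) (hn : 1 ≤ n) (φ : EuclideanSpace ℝ (Fin n) → ℝ)
    (hφ : DualOrlicz.ConditionC1 φ) (K : ℕ → DualOrlicz.KO n) (L : DualOrlicz.KO n)
    (hK : Tendsto K atTop (𝓝 L)) :
    (∀ M : DualOrlicz.KO n, DualOrlicz.IsCurvatureMeasure φ (M.1 : Set (EuclideanSpace ℝ (Fin n)))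
      (DualOrlicz.curvatureMeasure φ (M.1 : Set (EuclideanSpace ℝ (Fin n))))) ∧
    Tendsto
      (fun i => DualOrlicz.curvatureMeasure φ ((K i).1 : Set (EuclideanSpace ℝ (Fin n))))
      atTop
      (𝓝 (DualOrlicz.curvatureMeasure φ (L.1 : Set (EuclideanSpace ℝ (Fin n))))) := by
  exact ⟨fun M => DualOrlicz.isCurvatureMeasure_curvatureMeasure hφ M,
    DualOrlicz.tendsto_curvatureMeasure hφ hK⟩
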